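/- **Theorem.** Let $T>0$, $n,m\in\mathbb N$, and let $A:[0,T]\to\mathbb R^{n\times n}$, $B:[0,T]\to\mathbb R^{n\times m}$, $C:[0,T]\to\mathbb R^{m\times n}$, $D:[0,T]\to\mathbb R^{m\times m}$ be continuous. Consider the linear time-varying differential repetitive process $$\dot x_{k+1}(t)=A(t)x_{k+1}(t)+B(t)y_k(t),\qquad y_{k+1}(t)=C(t)x_{k+1}(t)+D(t)y_k(t),\qquad t\in[0,T],\ k=0,1,2,\dots$$ with initial profile $y_0\in L_\infty([0,T];\mathbb R^m)$ and initial states $\mathbf x(0)=\{x_{k+1}(0)\}_{k\ge 0}\subset\mathbb R^n$. The differential equation is understood in the Carathéodory sense ($x_{k+1}$ is continuous and satisfies the integrated equation) and the output equation almost everywhere. Here $\|y\|_\infty$ is the essential supremum norm on $[0,T]$, $\|\mathbf x(0)\|_{e_\lambda}=\sup_{k\ge0}\lambda^{-k}\|x_{k+1}(0)\|$ for $\lambda\in(0,1]$, and $\mathbb R^n,\mathbb R^m$ carry the maximum norm. Call the process *globally exponentially stable* if 1. for every $\epsilon>0$ there is $\delta_1\in(0,\epsilon)$ such that $\|y_0\|_\infty+\|\mathbf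 x(0)\|_{e_1}<\delta_1$ implies $\|y_k\|_\infty<\epsilon$ for all $k$; 2. for arbitrarily large $\delta_2>0$: if $\|y_0\|_\infty+\|\mathbf x(0)\|_{e_1}<\delta_2$ and $x_{k+1}(0)\to0$ as $k\to\infty$, then $\|y_k\|_\infty\to0$; 3. there are continuous nondecreasing functions $K:(0,1)\to[1,\infty)$ and $\gamma:(0,1)\to(0,1)$ such that, for arbitrarily large $\delta_3>0$: for all $\lambda\in(0,1)$, $\|y_0\|_\infty+\|\mathbf x(0)\|_{e_\lambda}<\delta_3$ implies $\|y_k\|_\infty\le K(\lambda)\gamma(\lambda)^k\bigl(\|y_0\|_\infty+\|\mathbf x(0)\|_{e_\lambda}\bigr)$ for all $k\ge 0$. Call it *globally exponentially stable with zero initial states* if the same three conditions hold when only $\mathbf x(0)=0$ is considered. Then the following are equivalent: (i) the process is globally exponentially stable; (ii) the process is globally exponentially stable with zero initial states; (iii) $\max_{t\in[0,T]}\rho(D(t))<1$ (the maximum being attained), where $\rho$ is the spectral radius, i.e. the largest modulus of a complex eigenvalue (and $0$ if $m=0$). -/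

import Mathlib

open MeasureTheory Filter Topology
open scoped ENNReal Matrix

/-- Data of a linear time-varying differential repetitive process on the pass `[0, T]`,
with state in `ℝⁿ` and output in `ℝᵐ`. -/
structure LTVProcess (n m : ℕ) where
  T : ℝ
  A : ℝ → Matrix (Fin n) (Fin n) ℝ
  B : ℝ → Matrix (Fin n) (Fin m) ℝ
  C : ℝ → Matrix (Fin m) (Fin n) ℝ
  D : ℝ → Matrix (Fin m) (Fin m) ℝ

namespace LTVProcess

variable {n m : ℕ}

/-- The (possibly infinite) essential supremum norm of a signal on `[0, T]`. -/
noncomputable def signalNorm (P : LTVProcess n m) (y : ℝ → Fin m → ℝ) : ℝ≥0∞ :=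
  eLpNorm y ∞ (volume.restrict (Set.Icc 0 P.T))

/-- The (possibly infinite) exponential norm `sup_k lam⁻ᵏ ‖b_{k+1}‖`; the sequence
`b_1, b_2, …` is indexed from `0`, so that `b k` stands for `b_{k+1}`. -/
noncomputable def expNorm {p : ℕ} (lam : ℝ) (b : ℕ → Fin p → ℝ) : ℝ≥0∞ :=
  ⨆ k : ℕ, ENNReal.ofReal ((lam ^ k)⁻¹ * ‖b k‖)

/-- `(x, y)` is a solution of the process with initial states `x0`: `x k`, `x0 k` stand for
`x_{k+1}`, `x_{k+1}(0)`, and `y k` for `y_k`. The initial profile `y_0` is in `L_∞[0, T]`; the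
differential equation holds in the Carathéodory sense, i.e. `x_{k+1}` is a continuous solution
of the integrated equation; outputs are determined almost everywhere. -/
structure IsSolution (P : LTVProcess n m) (x0 : ℕ → Fin n → ℝ)
    (x : ℕ → ℝ → Fin n → ℝ) (y : ℕ → ℝ → Fin m → ℝ) : Prop where
  memLp_zero : MemLp (y 0) ∞ (volume.restrict (Set.Icc 0 P.T))
  continuousOn_state : ∀ k, ContinuousOn (x k) (Set.Icc 0 P.T)
  state_eq : ∀ k, ∀ t ∈ Set.Icc 0 P.T,
    x k t = x0 k + ∫ s in (0 : ℝ)..t, (P.A s *ᵥ x k s + P.B s *ᵥ y k s)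
  output_eq : ∀ k, ∀ᵐ t ∂(volume.restrict (Set.Icc 0 P.T)),
    y (k + 1) t = P.C t *ᵥ x k t + P.D t *ᵥ y k t

/-- Lyapunov stability, for initial state sequences restricted to `X`. -/
def LyapunovStable (P : LTVProcess n m) (X : Set (ℕ → Fin n → ℝ)) : Prop :=
  ∀ ε : ℝ, 0 < ε → ∃ δ₁ : ℝ, 0 < δ₁ ∧ δ₁ < ε ∧
    ∀ x0 ∈ X, ∀ x y, P.IsSolution x0 x y →
      P.signalNorm (y 0) + expNorm 1 x0 < ENNReal.ofReal δ₁ →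
      ∀ k, P.signalNorm (y k) < ENNReal.ofReal ε

/-- Initial data of size less than `δ₂` with initial states in `c₀` have outputs tending
to zero (initial state sequences restricted to `X`). -/
def AttractiveWithin (P : LTVProcess n m) (X : Set (ℕ → Fin n → ℝ)) (δ₂ : ℝ) : Prop :=
  ∀ x0 ∈ X, ∀ x y, P.IsSolution x0 x y →
    P.signalNorm (y 0) + expNorm 1 x0 < ENNReal.ofReal δ₂ → Tendsto x0 atTop (𝓝 0) →
    Tendsto (fun k => P.signalNorm (y k)) atTop (𝓝 0)

/-- The exponential estimate with gain `K` and rate `γ` for initial data of size less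
than `δ₃` (initial state sequences restricted to `X`). -/
def ExpBoundWithin (P : LTVProcess n m) (X : Set (ℕ → Fin n → ℝ)) (K γ : ℝ → ℝ)
    (δ₃ : ℝ) : Prop :=
  ∀ lam ∈ Set.Ioo (0 : ℝ) 1, ∀ x0 ∈ X, ∀ x y, P.IsSolution x0 x y →
    P.signalNorm (y 0) + expNorm lam x0 < ENNReal.ofReal δ₃ →
    ∀ k, P.signalNorm (y k) ≤
      ENNReal.ofReal (K lam * γ lam ^ k) * (P.signalNorm (y 0) + expNorm lam x0)

/-- Global asymptotic stability: Lyapunov stability, and `δ₂` can be chosen arbitrarily large. -/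
def GloballyAsymptoticallyStable (P : LTVProcess n m) (X : Set (ℕ → Fin n → ℝ)) : Prop :=
  P.LyapunovStable X ∧ ∀ R : ℝ, ∃ δ₂ : ℝ, 0 < δ₂ ∧ R < δ₂ ∧ P.AttractiveWithin X δ₂

/-- Global exponential stability for initial state sequences restricted to `X`: global
asymptotic stability, and for some continuous increasing `K : (0,1) → [1,∞)` and
`γ : (0,1) → (0,1)` the exponential estimate holds with `δ₃` arbitrarily large. -/
def GloballyExponentiallyStableOn (P : LTVProcess n m) (X : Set (ℕ → Fin n → ℝ)) : Prop :=
  P.GloballyAsymptoticallyStable X ∧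
  ∃ K γ : ℝ → ℝ,
    ContinuousOn K (Set.Ioo 0 1) ∧ MonotoneOn K (Set.Ioo 0 1) ∧
    (∀ lam ∈ Set.Ioo (0 : ℝ) 1, 1 ≤ K lam) ∧
    ContinuousOn γ (Set.Ioo 0 1) ∧ MonotoneOn γ (Set.Ioo 0 1) ∧
    (∀ lam ∈ Set.Ioo (0 : ℝ) 1, γ lam ∈ Set.Ioo (0 : ℝ) 1) ∧
    ∀ R : ℝ, ∃ δ₃ : ℝ, 0 < δ₃ ∧ R < δ₃ ∧ P.ExpBoundWithin X K γ δ₃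

/-- Global exponential stability: all initial state sequences are allowed. -/
def GloballyExponentiallyStable (P : LTVProcess n m) : Prop :=
  P.GloballyExponentiallyStableOn Set.univ

/-- Global exponential stability of the process with zero initial states. -/
def ZeroISGloballyExponentiallyStable (P : LTVProcess n m) : Prop :=
  P.GloballyExponentiallyStableOn {0}

/-- The spectral radius of the real matrix `D(t)`, i.e. the largest modulus of its complex
eigenvalues. -/
noncomputable def rhoD (P : LTVProcess n m) (t : ℝ) : ℝ≥0∞ :=
  spectralRadius ℂ ((P.D t).map Complex.ofReal)

end LTVProcess

-- The state feeds the output only through an integral, so one pass is multiplication by D(t) plus a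
-- Volterra term. In the norm sup e^{-σt}‖·‖ with σ large that term is small, so the powers of D(t)
-- alone decide stability.
--
-- Sufficiency. Gelfand's formula and compactness give ‖D(t)^k‖ ≤ M r^k with r < 1, uniformly in t
-- (`IsCompact.exists_norm_pow_le_geometric`). In the norm sup_i r^{-i}‖D(t)^i v‖ the matrix D(t)
-- contracts by r, and under the time weight the Volterra term costs O(1/σ). The outputs are thus
-- dominated by Z_{k+1} = q Z_k + c‖x_{k+1}(0)‖ with q < 1 (`exists_signalNorm_le_affineRecursion`),
-- and this scalar recursion yields all three stability conditions.
--
-- Necessity. With zero initial states and continuous y_0, the output y_k differs from D^k y_0 by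
-- O(‖y_0‖_{L¹}) (`exists_norm_sub_pow_mulVec_le`). Profiles of fixed height concentrating at t₀
-- therefore turn the exponential estimate into ‖D(t₀)^k‖ ≤ K γ^k, which forces ρ(D(t₀)) < 1. The
-- maximum is attained because ρ∘D is upper semicontinuous.

attribute [local instance] Matrix.linftyOpNormedAddCommGroup Matrix.linftyOpNormedSpace
  Matrix.linftyOpNormedRing Matrix.linftyOpNormedAlgebra

/-! ### Spectral radius and uniform decay of matrix powers -/

section MatrixNorm

variable {p q : ℕ}

/-- Only an inequality, since the identity has norm 0 when p = 0. -/
theorem Matrix.linfty_opNorm_one_le {𝕜 : Type*} [RCLike 𝕜] :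
    ‖(1 : Matrix (Fin p) (Fin p) 𝕜)‖ ≤ 1 := by
  rw [← Matrix.diagonal_one, Matrix.linfty_opNorm_diagonal]
  exact (pi_norm_le_iff_of_nonneg zero_le_one).2 fun i => by simp

theorem Matrix.linfty_opNorm_pow_le (A : Matrix (Fin p) (Fin p) ℝ) (k : ℕ) :
    ‖A ^ k‖ ≤ ‖A‖ ^ k := by
  rcases Nat.eq_zero_or_pos k with rfl | hk
  · simpa using Matrix.linfty_opNorm_one_le
  · exact norm_pow_le' A hk

theorem Matrix.linfty_opNNNorm_map_ofReal (A : Matrix (Fin p) (Fin p) ℝ) :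
    ‖A.map Complex.ofReal‖₊ = ‖A‖₊ := by
  simp [Matrix.linfty_opNNNorm_def]

theorem Matrix.map_ofReal_pow (A : Matrix (Fin p) (Fin p) ℝ) (k : ℕ) :
    A.map Complex.ofReal ^ k = (A ^ k).map Complex.ofReal :=
  (map_pow (Complex.ofRealHom.mapMatrix) A k).symm

theorem Matrix.spectralRadius_le_norm_pow (A : Matrix (Fin p) (Fin p) ℝ) {k : ℕ} (hk : k ≠ 0) :
    spectralRadius ℂ (A.map Complex.ofReal) ≤ (‖A ^ k‖₊ : ℝ≥0∞) ^ (1 / k : ℝ) := by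
  obtain ⟨l, rfl⟩ := Nat.exists_eq_succ_of_ne_zero hk
  refine (spectrum.spectralRadius_le_pow_nnnorm_pow_one_div ℂ (A.map Complex.ofReal) l).trans ?_
  rw [Matrix.map_ofReal_pow, Matrix.linfty_opNNNorm_map_ofReal]
  have h1 : (‖(1 : Matrix (Fin p) (Fin p) ℂ)‖₊ : ℝ≥0∞) ^ (1 / (l + 1) : ℝ) ≤ 1 := by
    refine ENNReal.rpow_le_one ?_ (by positivity)
    exact_mod_cast (Matrix.linfty_opNorm_one_le (p := p) (𝕜 := ℂ))
  simpa using mul_le_mul_right h1 ((‖A ^ (l + 1)‖₊ : ℝ≥0∞) ^ (1 / (l + 1) : ℝ))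

theorem Matrix.tendsto_norm_pow_spectralRadius (A : Matrix (Fin p) (Fin p) ℝ) :
    Tendsto (fun k : ℕ => (‖A ^ k‖₊ : ℝ≥0∞) ^ (1 / k : ℝ)) atTop
      (𝓝 (spectralRadius ℂ (A.map Complex.ofReal))) := by
  have := spectrum.pow_nnnorm_pow_one_div_tendsto_nhds_spectralRadius (A.map Complex.ofReal)
  simpa only [Matrix.map_ofReal_pow, Matrix.linfty_opNNNorm_map_ofReal] using this

/-- The spectral radius is both a lower bound and the limit of the functions ‖D^k‖^{1/k}, k ≠ 0,
each continuous in t. -/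
theorem upperSemicontinuousOn_spectralRadius {D : ℝ → Matrix (Fin p) (Fin p) ℝ} {s : Set ℝ}
    (hD : ContinuousOn D s) :
    UpperSemicontinuousOn (fun t => spectralRadius ℂ ((D t).map Complex.ofReal)) s := by
  intro t ht c hc
  obtain ⟨k, hk, hk0⟩ := (((Matrix.tendsto_norm_pow_spectralRadius (D t)).eventually
    (gt_mem_nhds hc)).and (eventually_ne_atTop 0)).exists
  have hcont : ContinuousOn (fun u => (‖D u ^ k‖₊ : ℝ≥0∞) ^ (1 / k : ℝ)) s :=
    (ENNReal.continuous_rpow_const.comp ENNReal.continuous_coe).comp_continuousOn (hD.pow k).nnnorm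
  filter_upwards [(hcont t ht).eventually (gt_mem_nhds hk)] with u hu
  exact (Matrix.spectralRadius_le_norm_pow _ hk0).trans_lt hu

theorem Matrix.exists_norm_pow_lt_half {A : Matrix (Fin p) (Fin p) ℝ}
    (hA : spectralRadius ℂ (A.map Complex.ofReal) < 1) : ∃ k : ℕ, k ≠ 0 ∧ ‖A ^ k‖ < 1 / 2 := by
  obtain ⟨r, hr, hr1⟩ := ENNReal.lt_iff_exists_nnreal_btwn.1 hA
  have hr1' : r < 1 := by exact_mod_cast hr1
  have hpow : ∀ᶠ k : ℕ in atTop, (r : ℝ) ^ k < 1 / 2 :=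
    (tendsto_pow_atTop_nhds_zero_of_lt_one r.2 (by exact_mod_cast hr1')).eventually
      (gt_mem_nhds (by norm_num))
  obtain ⟨k, ⟨hk, hk0⟩, hk2⟩ := ((((Matrix.tendsto_norm_pow_spectralRadius A).eventually
    (gt_mem_nhds hr)).and (eventually_ne_atTop 0)).and hpow).exists
  refine ⟨k, hk0, lt_of_le_of_lt ?_ hk2⟩
  have hkpos : (0 : ℝ) < k := by exact_mod_cast Nat.pos_of_ne_zero hk0
  have h := ENNReal.rpow_le_rpow hk.le hkpos.le
  rw [← ENNReal.rpow_mul, one_div_mul_cancel hkpos.ne', ENNReal.rpow_one,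
    ENNReal.rpow_natCast] at h
  exact_mod_cast h

/-- Division of k by N with remainder: full blocks contribute powers of 1/2, the remainder at most
d^N, and the factor 2 pays for r^(k % N) ≥ 1/2. Strict versions of the two norm hypotheses are open
in A, so the constants can be shared by nearby matrices. -/
theorem Matrix.norm_pow_le_geometric {A : Matrix (Fin p) (Fin p) ℝ} {N : ℕ} {d r : ℝ}
    (hA : ‖A ^ N‖ ≤ 1 / 2) (hd : ‖A‖ ≤ d) (hd1 : 1 ≤ d) (hN : N ≠ 0) (hr : 0 < r) (hr1 : r < 1)
    (hrN : r ^ N = 1 / 2) (k : ℕ) : ‖A ^ k‖ ≤ 2 * d ^ N * r ^ k := by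
  have hmod : k % N < N := Nat.mod_lt _ (Nat.pos_of_ne_zero hN)
  have h1 : ‖(A ^ N) ^ (k / N)‖ ≤ (1 / 2) ^ (k / N) :=
    (Matrix.linfty_opNorm_pow_le _ _).trans (pow_le_pow_left₀ (norm_nonneg _) hA _)
  have h2 : ‖A ^ (k % N)‖ ≤ d ^ N :=
    (Matrix.linfty_opNorm_pow_le _ _).trans ((pow_le_pow_left₀ (norm_nonneg _) hd _).trans
      (pow_le_pow_right₀ hd1 hmod.le))
  have h3 : (1 / 2 : ℝ) ^ (k / N) ≤ 2 * r ^ k := by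
    have : r ^ N ≤ r ^ (k % N) := pow_le_pow_of_le_one hr.le hr1.le hmod.le
    have hk : r ^ k = (1 / 2) ^ (k / N) * r ^ (k % N) := by
      rw [← hrN, ← pow_mul, ← pow_add, Nat.div_add_mod]
    rw [hk]
    nlinarith [pow_pos (by norm_num : (0 : ℝ) < 1 / 2) (k / N)]
  calc ‖A ^ k‖ = ‖(A ^ N) ^ (k / N) * A ^ (k % N)‖ := by
        rw [← pow_mul, ← pow_add, Nat.div_add_mod]
    _ ≤ (1 / 2) ^ (k / N) * d ^ N :=
        (norm_mul_le _ _).trans (mul_le_mul h1 h2 (norm_nonneg _) (by positivity))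
    _ ≤ (2 * r ^ k) * d ^ N := by gcongr
    _ = 2 * d ^ N * r ^ k := by ring

/-- A continuous family of real matrices over a compact set whose spectral radii are less than
one has uniformly geometrically decaying powers. -/
theorem IsCompact.exists_norm_pow_le_geometric {D : ℝ → Matrix (Fin p) (Fin p) ℝ} {s : Set ℝ}
    (hs : IsCompact s) (hD : ContinuousOn D s)
    (hρ : ∀ t ∈ s, spectralRadius ℂ ((D t).map Complex.ofReal) < 1) :
    ∃ M r : ℝ, 0 ≤ M ∧ 0 < r ∧ r < 1 ∧ ∀ t ∈ s, ∀ k : ℕ, ‖D t ^ k‖ ≤ M * r ^ k := by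
  refine hs.induction_on
    (p := fun s => ∃ M r : ℝ, 0 ≤ M ∧ 0 < r ∧ r < 1 ∧ ∀ t ∈ s, ∀ k : ℕ, ‖D t ^ k‖ ≤ M * r ^ k)
    ⟨0, 1 / 2, le_rfl, by norm_num, by norm_num, by simp⟩ ?_ ?_ ?_
  · rintro s t hst ⟨M, r, hM, hr, hr1, h⟩
    exact ⟨M, r, hM, hr, hr1, fun u hu => h u (hst hu)⟩
  · rintro s t ⟨M, r, hM, hr, hr1, h⟩ ⟨M', r', hM', hr', hr1', h'⟩
    refine ⟨max M M', max r r', hM.trans (le_max_left _ _), hr.trans_le (le_max_left _ _),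
      max_lt hr1 hr1', ?_⟩
    rintro u (hu | hu) k
    · exact (h u hu k).trans (mul_le_mul (le_max_left _ _)
        (pow_le_pow_left₀ hr.le (le_max_left _ _) _) (by positivity)
        (hM.trans (le_max_left _ _)))
    · exact (h' u hu k).trans (mul_le_mul (le_max_right _ _)
        (pow_le_pow_left₀ hr'.le (le_max_right _ _) _) (by positivity)
        (hM.trans (le_max_left _ _)))
  · intro t ht
    obtain ⟨N, hN, hlt⟩ := Matrix.exists_norm_pow_lt_half (hρ t ht)
    have hN' : (0 : ℝ) < N := by exact_mod_cast Nat.pos_of_ne_zero hN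
    -- Both strict inequalities persist near t, so one pair (M, r) serves a whole neighbourhood.
    have e1 := ((hD.pow N).norm t ht).eventually (gt_mem_nhds hlt)
    have e2 := (hD.norm t ht).eventually (gt_mem_nhds (lt_add_one ‖D t‖))
    refine ⟨_, e1.and e2, 2 * (‖D t‖ + 1) ^ N, (1 / 2 : ℝ) ^ (1 / N : ℝ), by positivity,
      by positivity, Real.rpow_lt_one (by norm_num) (by norm_num) (by positivity), ?_⟩
    rintro u ⟨hu1, hu2⟩ k
    refine Matrix.norm_pow_le_geometric hu1.le hu2.le (by linarith [norm_nonneg (D t)]) hN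
      (by positivity) (Real.rpow_lt_one (by norm_num) (by norm_num) (by positivity)) ?_ k
    rw [← Real.rpow_natCast, ← Real.rpow_mul (by norm_num), one_div_mul_cancel hN'.ne',
      Real.rpow_one]

theorem ContinuousOn.exists_linfty_opNorm_le {A : ℝ → Matrix (Fin p) (Fin q) ℝ} {s : Set ℝ}
    (hs : IsCompact s) (hA : ContinuousOn A s) : ∃ a : ℝ, 0 ≤ a ∧ ∀ t ∈ s, ‖A t‖ ≤ a := by
  obtain ⟨a, ha⟩ := hs.exists_bound_of_continuousOn hA
  exact ⟨max a 0, le_max_right _ _, fun t ht => (ha t ht).trans (le_max_left _ _)⟩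

theorem ContinuousOn.matrix_mulVec' {A : ℝ → Matrix (Fin p) (Fin q) ℝ} {v : ℝ → Fin q → ℝ}
    {s : Set ℝ} (hA : ContinuousOn A s) (hv : ContinuousOn v s) :
    ContinuousOn (fun t => A t *ᵥ v t) s :=
  (Continuous.matrix_mulVec continuous_fst continuous_snd).comp_continuousOn (hA.prodMk hv)

end MatrixNorm

/-! ### Weighted Gronwall estimate and linear differential equations -/

section LinearODE

theorem integral_exp_mul_le {σ t : ℝ} (hσ : 0 < σ) :
    ∫ s in (0 : ℝ)..t, Real.exp (σ * s) ≤ Real.exp (σ * t) / σ := by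
  rw [intervalIntegral.integral_comp_mul_left (fun u => Real.exp u) hσ.ne', integral_exp]
  simp only [mul_zero, Real.exp_zero, smul_eq_mul]
  rw [div_eq_inv_mul]
  gcongr
  linarith

/-- A Gronwall estimate in an exponentially weighted norm. -/
theorem le_two_mul_exp_of_le_integral {u : ℝ → ℝ} {T a b σ : ℝ} (hu : ContinuousOn u (Set.Icc 0 T))
    (hu0 : ∀ t ∈ Set.Icc 0 T, 0 ≤ u t) (ha : 0 ≤ a) (hσ : 0 < σ) (haσ : 2 * a ≤ σ)
    (h : ∀ t ∈ Set.Icc 0 T, u t ≤ b * Real.exp (σ * t) + a * ∫ s in (0 : ℝ)..t, u s) :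
    ∀ t ∈ Set.Icc 0 T, u t ≤ 2 * b * Real.exp (σ * t) := by
  intro t ht
  have hcont : ContinuousOn (fun t => Real.exp (-(σ * t)) * u t) (Set.Icc 0 T) :=
    ContinuousOn.mul (by fun_prop) hu
  -- The hypothesis is evaluated where e^{-σt} u(t) attains its maximum X. There the integral term
  -- is at most X/2 in weighted size, since a/σ ≤ 1/2, and is absorbed on the left.
  obtain ⟨w, hw, hmax⟩ := isCompact_Icc.exists_isMaxOn ⟨t, ht⟩ hcont
  set X := Real.exp (-(σ * w)) * u w with hX
  have hle : ∀ s ∈ Set.Icc 0 T, u s ≤ X * Real.exp (σ * s) := by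
    intro s hs
    have h1 : Real.exp (-(σ * s)) * u s ≤ X := hmax hs
    have h2 := mul_le_mul_of_nonneg_right h1 (Real.exp_pos (σ * s)).le
    rwa [mul_right_comm, ← Real.exp_add, neg_add_cancel, Real.exp_zero, one_mul] at h2
  have huw : u w = X * Real.exp (σ * w) := by
    rw [hX, mul_right_comm, ← Real.exp_add, neg_add_cancel, Real.exp_zero, one_mul]
  have hX0 : 0 ≤ X := mul_nonneg (Real.exp_pos _).le (hu0 w hw)
  have hsub : Set.uIcc 0 w ⊆ Set.Icc 0 T := by
    rw [Set.uIcc_of_le hw.1]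
    exact Set.Icc_subset_Icc_right hw.2
  have hint : ∫ s in (0 : ℝ)..w, u s ≤ X * (Real.exp (σ * w) / σ) := by
    calc ∫ s in (0 : ℝ)..w, u s ≤ ∫ s in (0 : ℝ)..w, X * Real.exp (σ * s) := by
          refine intervalIntegral.integral_mono_on hw.1 (hu.mono hsub).intervalIntegrable
            (Continuous.intervalIntegrable (by fun_prop) _ _) fun s hs => ?_
          exact hle s (Set.Icc_subset_Icc_right hw.2 hs)
      _ ≤ X * (Real.exp (σ * w) / σ) := by
          rw [intervalIntegral.integral_const_mul]
          exact mul_le_mul_of_nonneg_left (integral_exp_mul_le hσ) hX0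
  have hexp := Real.exp_pos (σ * w)
  have key : X ≤ 2 * b := by
    have h1 := h w hw
    have h2 : a * (X * (Real.exp (σ * w) / σ)) ≤ X * Real.exp (σ * w) / 2 := by
      have : a / σ ≤ 1 / 2 := by rw [div_le_iff₀ hσ]; linarith
      calc a * (X * (Real.exp (σ * w) / σ)) = a / σ * (X * Real.exp (σ * w)) := by ring
        _ ≤ 1 / 2 * (X * Real.exp (σ * w)) := by gcongr
        _ = _ := by ring
    have h3 := mul_le_mul_of_nonneg_left hint ha
    rw [huw] at h1
    have h4 : X * Real.exp (σ * w) ≤ (2 * b) * Real.exp (σ * w) := by linarith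
    exact le_of_mul_le_mul_right h4 hexp
  exact (hle t ht).trans (mul_le_mul_of_nonneg_right key (Real.exp_pos _).le)

/-- Weighted a priori bound for a state trajectory whose velocity has at most linear growth. -/
theorem norm_le_exp_of_eq_integral {n : ℕ} {x F : ℝ → Fin n → ℝ} {x₀ : Fin n → ℝ} {w : ℝ → ℝ}
    {T a b σ : ℝ} (hx : ContinuousOn x (Set.Icc 0 T)) (ha : 0 ≤ a) (hσ : 0 < σ) (haσ : 2 * a ≤ σ)
    (heq : ∀ t ∈ Set.Icc 0 T, x t = x₀ + ∫ s in (0 : ℝ)..t, F s)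
    (hF : ∀ᵐ s ∂(volume.restrict (Set.Icc 0 T)), ‖F s‖ ≤ a * ‖x s‖ + w s)
    (hw : ContinuousOn w (Set.Icc 0 T))
    (hwb : ∀ t ∈ Set.Icc 0 T, ∫ s in (0 : ℝ)..t, w s ≤ b * Real.exp (σ * t)) :
    ∀ t ∈ Set.Icc 0 T, ‖x t‖ ≤ 2 * (‖x₀‖ + b) * Real.exp (σ * t) := by
  refine le_two_mul_exp_of_le_integral hx.norm (fun _ _ => norm_nonneg _) ha hσ haσ fun t ht => ?_
  have hsub : Set.uIcc 0 t ⊆ Set.Icc 0 T := by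
    rw [Set.uIcc_of_le ht.1]
    exact Set.Icc_subset_Icc_right ht.2
  have hi1 : IntervalIntegrable (fun s => a * ‖x s‖) volume 0 t :=
    (continuousOn_const.mul (hx.mono hsub).norm).intervalIntegrable
  have hi2 : IntervalIntegrable w volume 0 t := (hw.mono hsub).intervalIntegrable
  have hle : ‖∫ s in (0 : ℝ)..t, F s‖ ≤ ∫ s in (0 : ℝ)..t, (a * ‖x s‖ + w s) := by
    refine intervalIntegral.norm_integral_le_of_norm_le ht.1 ?_ (hi1.add hi2)
    rw [ae_restrict_iff' measurableSet_Icc] at hF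
    filter_upwards [hF] with s hs hst
    exact hs ⟨hst.1.le, hst.2.trans ht.2⟩
  rw [intervalIntegral.integral_add hi1 hi2, intervalIntegral.integral_const_mul] at hle
  have h1 : ‖x₀‖ ≤ ‖x₀‖ * Real.exp (σ * t) :=
    le_mul_of_one_le_right (norm_nonneg _) (Real.one_le_exp (mul_nonneg hσ.le ht.1))
  calc ‖x t‖ ≤ ‖x₀‖ + ‖∫ s in (0 : ℝ)..t, F s‖ := by
        rw [heq t ht]
        exact norm_add_le _ _
    _ ≤ (‖x₀‖ + b) * Real.exp (σ * t) + a * ∫ s in (0 : ℝ)..t, ‖x s‖ := by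
        linarith [hwb t ht]

variable {n : ℕ}

/-- Coordinatewise truncation of a vector to the cube `[-R, R]ⁿ`. -/
noncomputable def clipVec (R : ℝ) (v : Fin n → ℝ) : Fin n → ℝ := fun i => max (-R) (min (v i) R)

theorem lipschitzWith_clipVec (R : ℝ) : LipschitzWith 1 (clipVec R : (Fin n → ℝ) → Fin n → ℝ) :=
  LipschitzWith.of_dist_le_mul fun v w => by
    rw [NNReal.coe_one, one_mul]
    refine (dist_pi_le_iff dist_nonneg).2 fun i => ?_
    refine le_trans ?_ (dist_le_pi_dist v w i)
    simp only [clipVec, Real.dist_eq]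
    refine (abs_max_sub_max_le_max _ _ _ _).trans ?_
    refine max_le (by simp) ((abs_min_sub_min_le_max _ _ _ _).trans ?_)
    simp

theorem norm_clipVec_le {R : ℝ} (hR : 0 ≤ R) (v : Fin n → ℝ) : ‖clipVec R v‖ ≤ R := by
  refine (pi_norm_le_iff_of_nonneg hR).2 fun i => ?_
  rw [Real.norm_eq_abs, abs_le]
  exact ⟨le_max_left _ _, max_le (by linarith) (min_le_right _ _)⟩

theorem norm_clipVec_le_norm {R : ℝ} (hR : 0 ≤ R) (v : Fin n → ℝ) : ‖clipVec R v‖ ≤ ‖v‖ := by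
  have h0 : clipVec R (0 : Fin n → ℝ) = 0 := by
    funext i
    simp [clipVec, hR]
  have := (lipschitzWith_clipVec (n := n) R).dist_le_mul v 0
  simpa [h0] using this

theorem clipVec_eq_self {R : ℝ} {v : Fin n → ℝ} (hv : ‖v‖ ≤ R) : clipVec R v = v := by
  funext i
  have := abs_le.1 (((Real.norm_eq_abs _).symm.le.trans (norm_le_pi_norm v i)).trans hv)
  simp [clipVec, this.1, this.2]

/-- Global existence for linear differential equations with continuous data. -/
theorem exists_solution_linear_ode {T : ℝ} (hT : 0 ≤ T) {A : ℝ → Matrix (Fin n) (Fin n) ℝ}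
    {g : ℝ → Fin n → ℝ} (hA : ContinuousOn A (Set.Icc 0 T)) (hg : ContinuousOn g (Set.Icc 0 T)) :
    ∃ x : ℝ → Fin n → ℝ, ContinuousOn x (Set.Icc 0 T) ∧
      ∀ t ∈ Set.Icc 0 T, x t = ∫ s in (0 : ℝ)..t, (A s *ᵥ x s + g s) := by
  obtain ⟨a, ha, hAa⟩ := hA.exists_linfty_opNorm_le isCompact_Icc
  obtain ⟨b', hgb'⟩ := isCompact_Icc.exists_bound_of_continuousOn hg
  have hb : 0 ≤ b' := (norm_nonneg _).trans (hgb' 0 ⟨le_rfl, hT⟩)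
  set σ : ℝ := 2 * a + 1 with hσ
  have hσ0 : 0 < σ := by positivity
  set R : ℝ := 2 * (b' * T) * Real.exp (σ * T) with hR
  have hR0 : 0 ≤ R := by positivity
  let f : ℝ → (Fin n → ℝ) → Fin n → ℝ := fun t v => A t *ᵥ clipVec R v + g t
  let L : NNReal := ⟨a * R + b', by positivity⟩
  let a' : NNReal := L * ⟨T, hT⟩
  have hfL : ∀ t ∈ Set.Icc 0 T, ∀ v, ‖f t v‖ ≤ L := by
    intro t ht v
    refine (norm_add_le _ _).trans (add_le_add ?_ (hgb' t ht))
    exact (Matrix.linfty_opNorm_mulVec _ _).trans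
      (mul_le_mul (hAa t ht) (norm_clipVec_le hR0 v) (norm_nonneg _) ha)
  have hpl : IsPicardLindelof f (⟨0, le_rfl, hT⟩ : Set.Icc 0 T) 0 a' 0 L ⟨a, ha⟩ := by
    refine ⟨fun t ht => ?_, fun v _ => ?_, fun t ht v _ => hfL t ht v, ?_⟩
    · refine LipschitzWith.lipschitzOnWith (LipschitzWith.of_dist_le_mul fun v w => ?_)
      simp only [f, dist_add_right]
      rw [dist_eq_norm, ← Matrix.mulVec_sub]
      refine (Matrix.linfty_opNorm_mulVec _ _).trans (mul_le_mul (hAa t ht) ?_ (norm_nonneg _) ha)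
      rw [← dist_eq_norm]
      simpa using (lipschitzWith_clipVec R).dist_le_mul v w
    · exact (hA.matrix_mulVec' continuousOn_const).add hg
    · have ha' : (a' : ℝ) = L * T := NNReal.coe_mul _ _
      rw [ha']
      simp [hT]
  obtain ⟨x, hx0, hx⟩ := hpl.exists_eq_forall_mem_Icc_hasDerivWithinAt₀
  have hxc : ContinuousOn x (Set.Icc 0 T) := fun t ht => (hx t ht).continuousWithinAt
  have hfc : ContinuousOn (fun s => f s (x s)) (Set.Icc 0 T) :=
    (hA.matrix_mulVec' ((lipschitzWith_clipVec R).continuous.comp_continuousOn hxc)).add hg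
  have heq : ∀ t ∈ Set.Icc 0 T, x t = ∫ s in (0 : ℝ)..t, f s (x s) := by
    intro t ht
    have hsub : Set.Icc 0 t ⊆ Set.Icc 0 T := Set.Icc_subset_Icc_right ht.2
    rw [intervalIntegral.integral_eq_sub_of_hasDeriv_right_of_le ht.1 (hxc.mono hsub)
      (fun s hs => ((hx s (hsub ⟨hs.1.le, hs.2.le⟩)).hasDerivAt
        (Icc_mem_nhds hs.1 (hs.2.trans_le ht.2))).hasDerivWithinAt)
      ((hfc.mono (by rwa [Set.uIcc_of_le ht.1])).intervalIntegrable)]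
    simpa using (congrArg (x t - ·) hx0).symm
  have hbound : ∀ t ∈ Set.Icc 0 T, ‖x t‖ ≤ R := by
    intro t ht
    have := norm_le_exp_of_eq_integral (x₀ := 0) (w := fun _ => b') (b := b' * T) hxc ha hσ0
      (by linarith) (by simpa using heq) ?_ continuousOn_const ?_ t ht
    · refine this.trans ?_
      rw [hR, norm_zero, zero_add]
      gcongr
      exact ht.2
    · refine (ae_restrict_iff' measurableSet_Icc).2 (Eventually.of_forall fun s hs => ?_)
      refine (norm_add_le _ _).trans (add_le_add ?_ (hgb' s hs))
      exact (Matrix.linfty_opNorm_mulVec _ _).trans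
        (mul_le_mul (hAa s hs) (norm_clipVec_le_norm hR0 _) (norm_nonneg _) ha)
    · intro s hs
      rw [intervalIntegral.integral_const, smul_eq_mul, sub_zero, mul_comm s]
      refine (mul_le_mul_of_nonneg_left hs.2 hb).trans
        (le_mul_of_one_le_right (by positivity) (Real.one_le_exp (mul_nonneg hσ0.le hs.1)))
  refine ⟨x, hxc, fun t ht => ?_⟩
  rw [heq t ht]
  refine intervalIntegral.integral_congr fun s hs => ?_
  rw [Set.uIcc_of_le ht.1] at hs
  simp only [f]
  rw [clipVec_eq_self (hbound s ⟨hs.1, hs.2.trans ht.2⟩)]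

end LinearODE

/-! ### Stable scalar recursions with forcing -/

section AffineRecursion

/-- A rate g ≥ (1 + q)/2 leaves a gap g - q ≥ (1 - q)/2, so the summand 2c/(1 - q) of the gain pays
for the forcing at each step. The summand M covers the start, and the 1 makes the gain at least 1,
as required of K. -/
theorem affineRecursion_le_geometric {Z e : ℕ → ℝ} {q c M S E lam g : ℝ} (hq : 0 < q) (hq1 : q < 1)
    (hc : 0 ≤ c) (hM : 0 ≤ M) (hS : 0 ≤ S) (hE : 0 ≤ E) (hlam : 0 ≤ lam)
    (hZ0 : Z 0 = M * S) (hZ : ∀ k, Z (k + 1) = q * Z k + c * e k)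
    (he : ∀ k, e k ≤ lam ^ k * E) (hg : (1 + q) / 2 ≤ g) (hlg : lam ≤ g) (k : ℕ) :
    Z k ≤ (1 + M + 2 * c / (1 - q)) * g ^ k * (S + E) := by
  have h1q : 0 < 1 - q := sub_pos.2 hq1
  have hcq : 0 ≤ 2 * c / (1 - q) := by positivity
  induction k with
  | zero =>
    rw [hZ0, pow_zero, mul_one]
    nlinarith [mul_nonneg hM hE, mul_nonneg hcq hS, mul_nonneg hcq hE]
  | succ k ih =>
    have hg0 : 0 ≤ g ^ k := pow_nonneg (hlam.trans hlg) k
    have h1 : c * e k ≤ c * (g ^ k * (S + E)) := by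
      refine mul_le_mul_of_nonneg_left ((he k).trans ?_) hc
      exact mul_le_mul (pow_le_pow_left₀ hlam hlg k) (by linarith) hE hg0
    have h2 : c ≤ (1 + M + 2 * c / (1 - q)) * (g - q) := by
      have h3 : c = 2 * c / (1 - q) * ((1 - q) / 2) := by field_simp
      calc c = 2 * c / (1 - q) * ((1 - q) / 2) := h3
        _ ≤ (1 + M + 2 * c / (1 - q)) * (g - q) := by
          refine mul_le_mul ?_ ?_ ?_ ?_ <;> linarith
    have h4 := mul_le_mul_of_nonneg_right h2 (mul_nonneg hg0 (add_nonneg hS hE))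
    have h5 := mul_le_mul_of_nonneg_left ih hq.le
    rw [hZ, pow_succ]
    linarith

theorem tendsto_affineRecursion_zero {Z e : ℕ → ℝ} {q c : ℝ} (hq : 0 < q) (hq1 : q < 1)
    (hZ : ∀ k, Z (k + 1) = q * Z k + c * e k) (hZ0 : ∀ k, 0 ≤ Z k)
    (he : Tendsto e atTop (𝓝 0)) : Tendsto Z atTop (𝓝 0) := by
  refine Metric.tendsto_atTop.2 fun ε hε => ?_
  have hce : Tendsto (fun k => c * e k) atTop (𝓝 0) := by simpa using he.const_mul c
  have h1q : 0 < 1 - q := sub_pos.2 hq1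
  -- The threshold is chosen so that ε/2 is the fixed point of z ↦ q z + (1 - q) ε/2.
  obtain ⟨N, hN⟩ := eventually_atTop.1
    (hce.eventually (gt_mem_nhds (by positivity : 0 < (1 - q) * (ε / 2))))
  have hle : ∀ k, Z (N + k) ≤ q ^ k * Z N + ε / 2 := by
    intro k
    induction k with
    | zero => simp; linarith
    | succ k ih =>
      have h1 := hN (N + k) (Nat.le_add_right _ _)
      have h2 := mul_le_mul_of_nonneg_left ih hq.le
      rw [← add_assoc, hZ, pow_succ]
      linarith
  have hpow : Tendsto (fun k => q ^ k * Z N) atTop (𝓝 0) := by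
    simpa using (tendsto_pow_atTop_nhds_zero_of_lt_one hq.le hq1).mul_const (Z N)
  obtain ⟨K, hK⟩ := eventually_atTop.1 (hpow.eventually (gt_mem_nhds (half_pos hε)))
  refine ⟨N + K, fun k hk => ?_⟩
  obtain ⟨j, rfl⟩ := Nat.exists_eq_add_of_le ((Nat.le_add_right N K).trans hk)
  rw [Real.dist_eq, sub_zero, abs_of_nonneg (hZ0 _)]
  linarith [hle j, hK j (by omega)]

end AffineRecursion

/-! ### Sufficiency of the spectral condition -/

namespace LTVProcess

variable {n m : ℕ} {P : LTVProcess n m}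

theorem signalNorm_le_of_ae_bound {y : ℝ → Fin m → ℝ} {c : ℝ}
    (h : ∀ᵐ t ∂(volume.restrict (Set.Icc 0 P.T)), ‖y t‖ ≤ c) :
    P.signalNorm y ≤ ENNReal.ofReal c := by
  rw [signalNorm, eLpNorm_exponent_top]
  exact eLpNormEssSup_le_of_ae_bound h

theorem ae_norm_le_signalNorm {y : ℝ → Fin m → ℝ} (hy : P.signalNorm y ≠ ⊤) :
    ∀ᵐ t ∂(volume.restrict (Set.Icc 0 P.T)), ‖y t‖ ≤ (P.signalNorm y).toReal := by
  have := ae_le_eLpNormEssSup (f := y) (μ := volume.restrict (Set.Icc 0 P.T))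
  filter_upwards [this] with t ht
  have h : ‖y t‖ₑ ≤ P.signalNorm y := by rwa [signalNorm, eLpNorm_exponent_top]
  simpa using ENNReal.toReal_mono hy h

theorem norm_le_of_expNorm_ne_top {p : ℕ} {lam : ℝ} (hlam : 0 < lam) {b : ℕ → Fin p → ℝ}
    (hb : expNorm lam b ≠ ⊤) (k : ℕ) : ‖b k‖ ≤ lam ^ k * (expNorm lam b).toReal := by
  have h : ENNReal.ofReal ((lam ^ k)⁻¹ * ‖b k‖) ≤ expNorm lam b :=
    le_iSup (fun k => ENNReal.ofReal ((lam ^ k)⁻¹ * ‖b k‖)) k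
  have h1 := ENNReal.toReal_mono hb h
  rw [ENNReal.toReal_ofReal (by positivity)] at h1
  rwa [inv_mul_le_iff₀ (by positivity)] at h1

/-- If the powers of `D(t)` decay geometrically, the output norms are dominated by a stable scalar
recursion driven by the initial states. -/
theorem exists_signalNorm_le_affineRecursion
    (hA : ContinuousOn P.A (Set.Icc 0 P.T)) (hB : ContinuousOn P.B (Set.Icc 0 P.T))
    (hC : ContinuousOn P.C (Set.Icc 0 P.T)) (hD : ContinuousOn P.D (Set.Icc 0 P.T))
    (hρ : ∀ t ∈ Set.Icc 0 P.T, P.rhoD t < 1) :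
    ∃ M q c : ℝ, 0 ≤ M ∧ 0 < q ∧ q < 1 ∧ 0 ≤ c ∧ ∀ x0 x y, P.IsSolution x0 x y →
      ∃ Z : ℕ → ℝ, Z 0 = M * (P.signalNorm (y 0)).toReal ∧
        (∀ k, Z (k + 1) = q * Z k + c * ‖x0 k‖) ∧ (∀ k, 0 ≤ Z k) ∧
        ∀ k, P.signalNorm (y k) ≤ ENNReal.ofReal (Z k) := by
  obtain ⟨M, r, hM, hr, hr1, hDM⟩ := isCompact_Icc.exists_norm_pow_le_geometric hD hρ
  obtain ⟨a, ha, hAa⟩ := hA.exists_linfty_opNorm_le isCompact_Icc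
  obtain ⟨b, hb, hBb⟩ := hB.exists_linfty_opNorm_le isCompact_Icc
  obtain ⟨d, hd, hCd⟩ := hC.exists_linfty_opNorm_le isCompact_Icc
  have hr1' : 0 < 1 - r := sub_pos.2 hr1
  -- The term 2a serves the Gronwall estimate, the fraction gives q ≤ (1 + r)/2, and the 1 ensures σ
  -- > 0.
  set σ : ℝ := 2 * a + 4 * M * d * b / (1 - r) + 1 with hσ
  have hσ0 : 0 < σ := by positivity
  have haσ : 2 * a ≤ σ := by
    have : 0 ≤ 4 * M * d * b / (1 - r) := by positivity
    linarith
  have hη : 2 * M * d * (b / σ) ≤ (1 - r) / 2 := by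
    have h1 : 4 * M * d * b / (1 - r) ≤ σ := by linarith
    rw [div_le_iff₀ hr1'] at h1
    rw [← mul_div_assoc, div_le_iff₀ hσ0]
    linarith
  set q := r + 2 * M * d * (b / σ) with hq
  set W := Real.exp (σ * P.T) with hW
  have hq0 : 0 < q := by positivity
  have hq1 : q < 1 := by linarith
  refine ⟨W * M, q, W * (2 * M * d), by positivity, hq0, hq1, by positivity, ?_⟩
  intro x0 x y hsol
  set S := (P.signalNorm (y 0)).toReal with hS
  let Z : ℕ → ℝ := fun k => Nat.rec (M * S) (fun k z => q * z + 2 * M * d * ‖x0 k‖) k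
  have hZs : ∀ k, Z (k + 1) = q * Z k + 2 * M * d * ‖x0 k‖ := fun k => rfl
  have hZ0 : ∀ k, 0 ≤ Z k := by
    intro k
    induction k with
    | zero => exact mul_nonneg hM ENNReal.toReal_nonneg
    | succ k ih =>
      rw [hZs]
      positivity
  -- All powers i are carried at once: this bounds y_k in the norm adapted to D(t). The case i = 0
  -- alone would not be inductive, as ‖D(t)‖ may exceed 1.
  have key : ∀ k, ∀ᵐ t ∂(volume.restrict (Set.Icc 0 P.T)),
      ∀ i : ℕ, ‖P.D t ^ i *ᵥ y k t‖ ≤ r ^ i * Z k * Real.exp (σ * t) := by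
    intro k
    induction k with
    | zero =>
      have h0 : P.signalNorm (y 0) ≠ ⊤ := hsol.memLp_zero.eLpNorm_ne_top
      filter_upwards [ae_norm_le_signalNorm h0, ae_restrict_mem measurableSet_Icc] with t hty ht i
      have he : 1 ≤ Real.exp (σ * t) := Real.one_le_exp (mul_nonneg hσ0.le ht.1)
      calc ‖P.D t ^ i *ᵥ y 0 t‖ ≤ M * r ^ i * S :=
            (Matrix.linfty_opNorm_mulVec _ _).trans
              (mul_le_mul (hDM t ht i) hty (norm_nonneg _) (by positivity))
        _ = r ^ i * Z 0 := by
            change _ = r ^ i * (M * S)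
            ring
        _ ≤ r ^ i * Z 0 * Real.exp (σ * t) :=
            le_mul_of_one_le_right (mul_nonneg (by positivity) (hZ0 0)) he
    | succ k ih =>
      have hstate : ∀ t ∈ Set.Icc 0 P.T,
          ‖x k t‖ ≤ 2 * (‖x0 k‖ + b * Z k / σ) * Real.exp (σ * t) := by
        refine norm_le_exp_of_eq_integral (w := fun s => b * Z k * Real.exp (σ * s))
          (hsol.continuousOn_state k) ha hσ0 haσ (hsol.state_eq k) ?_
          (Continuous.continuousOn (by fun_prop)) ?_
        · filter_upwards [ih, ae_restrict_mem measurableSet_Icc] with s hs hsT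
          refine (norm_add_le _ _).trans (add_le_add ?_ ?_)
          · exact (Matrix.linfty_opNorm_mulVec _ _).trans
              (mul_le_mul_of_nonneg_right (hAa s hsT) (norm_nonneg _))
          · have h0 : ‖y k s‖ ≤ Z k * Real.exp (σ * s) := by simpa using hs 0
            rw [mul_assoc]
            exact (Matrix.linfty_opNorm_mulVec _ _).trans
              (mul_le_mul (hBb s hsT) h0 (norm_nonneg _) hb)
        · intro t _
          rw [intervalIntegral.integral_const_mul, mul_div_assoc, mul_assoc, mul_assoc b,
            div_mul_eq_mul_div, mul_div_assoc]
          exact mul_le_mul_of_nonneg_left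
            (mul_le_mul_of_nonneg_left (integral_exp_mul_le hσ0) (hZ0 k)) hb
      filter_upwards [ih, hsol.output_eq k, ae_restrict_mem measurableSet_Icc] with t hti hout ht i
      have h1 : ‖P.D t ^ i *ᵥ (P.C t *ᵥ x k t)‖ ≤
          M * r ^ i * (d * (2 * (‖x0 k‖ + b * Z k / σ) * Real.exp (σ * t))) :=
        (Matrix.linfty_opNorm_mulVec _ _).trans (mul_le_mul (hDM t ht i)
          ((Matrix.linfty_opNorm_mulVec _ _).trans
            (mul_le_mul (hCd t ht) (hstate t ht) (norm_nonneg _) hd))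
          (norm_nonneg _) (by positivity))
      -- D^i (D y_k) = D^{i+1} y_k, so the shift in i gains the factor r.
      have h2 := hti (i + 1)
      rw [pow_succ, ← Matrix.mulVec_mulVec] at h2
      rw [hout, Matrix.mulVec_add]
      refine (norm_add_le _ _).trans ((add_le_add h1 h2).trans_eq ?_)
      rw [hZs, hq, pow_succ]
      ring
  refine ⟨fun k => W * Z k, ?_, fun k => ?_, fun k => by have := hZ0 k; positivity, fun k => ?_⟩
  · change W * (M * S) = _
    ring
  · simp only [hZs]
    ring
  · refine signalNorm_le_of_ae_bound ?_
    filter_upwards [key k, ae_restrict_mem measurableSet_Icc] with t hti ht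
    have h0 : ‖y k t‖ ≤ Z k * Real.exp (σ * t) := by simpa using hti 0
    rw [mul_comm W]
    refine h0.trans (mul_le_mul_of_nonneg_left ?_ (hZ0 k))
    exact Real.exp_le_exp.2 (mul_le_mul_of_nonneg_left ht.2 hσ0.le)

theorem globallyExponentiallyStable_of_rhoD_lt_one
    (hA : ContinuousOn P.A (Set.Icc 0 P.T)) (hB : ContinuousOn P.B (Set.Icc 0 P.T))
    (hC : ContinuousOn P.C (Set.Icc 0 P.T)) (hD : ContinuousOn P.D (Set.Icc 0 P.T))
    (hρ : ∀ t ∈ Set.Icc 0 P.T, P.rhoD t < 1) : P.GloballyExponentiallyStable := by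
  obtain ⟨M, q, c, hM, hq, hq1, hc, hmain⟩ :=
    exists_signalNorm_le_affineRecursion hA hB hC hD hρ
  have h1q : 0 < 1 - q := sub_pos.2 hq1
  set K : ℝ := 1 + M + 2 * c / (1 - q) with hK
  have hK1 : 1 ≤ K := by
    have : 0 ≤ 2 * c / (1 - q) := by positivity
    linarith
  -- The value lam = g = 1 is allowed and gives Lyapunov stability; lam < 1 gives the exponential
  -- estimate.
  have hbound : ∀ lam g : ℝ, 0 < lam → (1 + q) / 2 ≤ g → lam ≤ g → ∀ x0 x y,
      P.IsSolution x0 x y → P.signalNorm (y 0) + expNorm lam x0 ≠ ⊤ → ∀ k,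
      P.signalNorm (y k) ≤
        ENNReal.ofReal (K * g ^ k) * (P.signalNorm (y 0) + expNorm lam x0) := by
    intro lam g hlam hg hlg x0 x y hsol hfin k
    obtain ⟨Z, hZ0, hZ, -, hyZ⟩ := hmain x0 x y hsol
    obtain ⟨hS, hE⟩ := ENNReal.add_ne_top.1 hfin
    refine (hyZ k).trans ?_
    rw [← ENNReal.ofReal_toReal hfin, ← ENNReal.ofReal_mul
      (mul_nonneg (by linarith) (pow_nonneg (by linarith) k)), ENNReal.toReal_add hS hE]
    exact ENNReal.ofReal_le_ofReal (affineRecursion_le_geometric hq hq1 hc hM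
      ENNReal.toReal_nonneg ENNReal.toReal_nonneg hlam.le hZ0 hZ
      (norm_le_of_expNorm_ne_top hlam hE) hg hlg k)
  -- The midpoint of max q lam and 1 is below 1, exceeds lam and is at least (1 + q)/2.
  refine ⟨⟨fun ε hε => ?_, fun R => ?_⟩, fun _ => K, fun lam => (1 + max q lam) / 2,
    continuousOn_const, fun _ _ _ _ _ => le_rfl, fun _ _ => hK1,
    Continuous.continuousOn (by fun_prop), fun s _ t _ hst => ?_, fun lam hlam => ?_, fun R => ?_⟩
  · have hK0 : 0 < K := by linarith
    refine ⟨ε / (2 * K), by positivity, (div_lt_self hε (by linarith)), ?_⟩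
    intro x0 _ x y hsol hlt k
    have h := hbound 1 1 one_pos (by linarith) le_rfl x0 x y hsol hlt.ne_top k
    rw [one_pow, mul_one] at h
    refine h.trans_lt ((mul_le_mul_right hlt.le _).trans_lt ?_)
    rw [← ENNReal.ofReal_mul hK0.le]
    refine (ENNReal.ofReal_lt_ofReal_iff hε).2 ?_
    have : K * (ε / (2 * K)) = ε / 2 := by field_simp
    linarith
  · refine ⟨max R 0 + 1, by positivity, by linarith [le_max_left R 0], ?_⟩
    intro x0 _ x y hsol _ hx0
    obtain ⟨Z, -, hZ, hZ0, hyZ⟩ := hmain x0 x y hsol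
    have hlim := tendsto_affineRecursion_zero hq hq1 hZ hZ0 (by simpa using hx0.norm)
    have hlim' := ENNReal.tendsto_ofReal hlim
    rw [ENNReal.ofReal_zero] at hlim'
    exact tendsto_of_tendsto_of_tendsto_of_le_of_le tendsto_const_nhds hlim'
      (fun _ => zero_le) hyZ
  · have := max_le_max_left q hst
    dsimp only
    linarith
  · have := max_lt hq1 hlam.2
    have := hq.trans_le (le_max_left q lam)
    constructor <;> dsimp only <;> linarith
  · refine ⟨max R 0 + 1, by positivity, by linarith [le_max_left R 0], ?_⟩
    intro lam hlam x0 _ x y hsol hlt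
    refine hbound lam _ hlam.1 ?_ ?_ x0 x y hsol hlt.ne_top
    · have := le_max_left q lam
      dsimp only
      linarith
    · have := le_max_right q lam
      have := max_lt hq1 hlam.2
      dsimp only
      linarith

end LTVProcess

/-! ### Concentrating test profiles -/

section Bump

/-- A bump of height one and width `h` around `t₀`. -/
noncomputable def lorentzBump (t₀ h t : ℝ) : ℝ := (1 + (t / h - t₀ / h) ^ 2)⁻¹

theorem lorentzBump_self (t₀ h : ℝ) : lorentzBump t₀ h t₀ = 1 := by simp [lorentzBump]

theorem lorentzBump_nonneg (t₀ h t : ℝ) : 0 ≤ lorentzBump t₀ h t := by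
  unfold lorentzBump
  positivity

theorem lorentzBump_le_one (t₀ h t : ℝ) : lorentzBump t₀ h t ≤ 1 :=
  inv_le_one_of_one_le₀ (by nlinarith [sq_nonneg (t / h - t₀ / h)])

theorem continuous_lorentzBump (t₀ h : ℝ) : Continuous (lorentzBump t₀ h) :=
  Continuous.inv₀ (by fun_prop) fun t => by positivity

/-- The primitive is h times an arctangent, of total variation πh: the mass vanishes with h while
the peak stays 1. -/
theorem integral_lorentzBump_le {t₀ h : ℝ} (hh : 0 < h) (a b : ℝ) :
    ∫ t in a..b, lorentzBump t₀ h t ≤ Real.pi * h := by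
  unfold lorentzBump
  rw [intervalIntegral.integral_comp_div_sub (fun u : ℝ => (1 + u ^ 2)⁻¹) hh.ne',
    integral_inv_one_add_sq, smul_eq_mul, mul_comm]
  refine mul_le_mul_of_nonneg_right ?_ hh.le
  linarith [Real.arctan_lt_pi_div_two (b / h - t₀ / h),
    Real.neg_pi_div_two_lt_arctan (a / h - t₀ / h)]

end Bump

/-! ### Necessity of the spectral condition -/

namespace LTVProcess

variable {n m : ℕ} {P : LTVProcess n m}

/-- Continuous outputs obeying the output equation everywhere can be evaluated at the single point
t₀. -/
theorem exists_continuous_solution (hT : 0 ≤ P.T)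
    (hA : ContinuousOn P.A (Set.Icc 0 P.T)) (hB : ContinuousOn P.B (Set.Icc 0 P.T))
    (hC : ContinuousOn P.C (Set.Icc 0 P.T)) (hD : ContinuousOn P.D (Set.Icc 0 P.T))
    {y0 : ℝ → Fin m → ℝ} (hy0 : ContinuousOn y0 (Set.Icc 0 P.T)) :
    ∃ x y, P.IsSolution 0 x y ∧ y 0 = y0 ∧ (∀ k, ContinuousOn (y k) (Set.Icc 0 P.T)) ∧
      ∀ k, ∀ t ∈ Set.Icc 0 P.T, y (k + 1) t = P.C t *ᵥ x k t + P.D t *ᵥ y k t := by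
  have hex := fun y : {y : ℝ → Fin m → ℝ // ContinuousOn y (Set.Icc 0 P.T)} =>
    exists_solution_linear_ode hT hA (hB.matrix_mulVec' y.2)
  choose X hXc hX using hex
  let Y : ℕ → {y : ℝ → Fin m → ℝ // ContinuousOn y (Set.Icc 0 P.T)} := fun k =>
    Nat.rec ⟨y0, hy0⟩ (fun _ y => ⟨fun t => P.C t *ᵥ X y t + P.D t *ᵥ y.1 t,
      (hC.matrix_mulVec' (hXc y)).add (hD.matrix_mulVec' y.2)⟩) k
  refine ⟨fun k => X (Y k), fun k => (Y k).1, ⟨?_, fun k => hXc _, fun k t ht => ?_, fun k => ?_⟩,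
    rfl, fun k => (Y k).2, fun k t _ => rfl⟩
  · obtain ⟨c, hc⟩ := isCompact_Icc.exists_bound_of_continuousOn hy0
    exact memLp_top_of_bound (hy0.aestronglyMeasurable measurableSet_Icc) c
      ((ae_restrict_iff' measurableSet_Icc).2 (Eventually.of_forall hc))
  · simpa using hX (Y k) t ht
  · exact Eventually.of_forall fun t => rfl

/-- Along solutions with zero initial states, `y_k` differs from `D^k y_0` by at most a constant
times the `L¹` norm of `y_0`. -/
theorem exists_norm_sub_pow_mulVec_le (hT : 0 ≤ P.T)
    (hA : ContinuousOn P.A (Set.Icc 0 P.T)) (hB : ContinuousOn P.B (Set.Icc 0 P.T))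
    (hC : ContinuousOn P.C (Set.Icc 0 P.T)) (hD : ContinuousOn P.D (Set.Icc 0 P.T)) (k : ℕ) :
    ∃ c : ℝ, 0 ≤ c ∧ ∀ x y, P.IsSolution 0 x y → ContinuousOn (y 0) (Set.Icc 0 P.T) →
      (∀ k, ∀ t ∈ Set.Icc 0 P.T, y (k + 1) t = P.C t *ᵥ x k t + P.D t *ᵥ y k t) →
      ∀ I : ℝ, 0 ≤ I → (∀ t ∈ Set.Icc 0 P.T, ∫ s in (0 : ℝ)..t, ‖y 0 s‖ ≤ I) →
      ∀ t ∈ Set.Icc 0 P.T, ‖y k t - P.D t ^ k *ᵥ y 0 t‖ ≤ c * I := by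
  obtain ⟨a, ha, hAa⟩ := hA.exists_linfty_opNorm_le isCompact_Icc
  obtain ⟨b, hb, hBb⟩ := hB.exists_linfty_opNorm_le isCompact_Icc
  obtain ⟨d, hd, hCd⟩ := hC.exists_linfty_opNorm_le isCompact_Icc
  obtain ⟨e, he, hDe⟩ := hD.exists_linfty_opNorm_le isCompact_Icc
  set σ : ℝ := 2 * a + 1 with hσ
  have hσ0 : 0 < σ := by positivity
  induction k with
  | zero => exact ⟨0, le_rfl, by simp⟩
  | succ k ih =>
    obtain ⟨c, hc, hck⟩ := ih
    -- The first summand bounds C x_k, since integrating the pointwise bound on y_k gives (cT + e^k)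
    -- I; the second is D applied to the previous error.
    refine ⟨d * (2 * (b * (c * P.T + e ^ k)) * Real.exp (σ * P.T)) + e * c, by positivity, ?_⟩
    intro x y hsol hy0 hout I hI hyI
    have hdiff := hck x y hsol hy0 hout I hI hyI
    have hyk : ∀ t ∈ Set.Icc 0 P.T, ‖y k t‖ ≤ c * I + e ^ k * ‖y 0 t‖ := by
      intro t ht
      have h1 : ‖P.D t ^ k *ᵥ y 0 t‖ ≤ e ^ k * ‖y 0 t‖ :=
        (Matrix.linfty_opNorm_mulVec _ _).trans (mul_le_mul_of_nonneg_right
          ((Matrix.linfty_opNorm_pow_le _ _).trans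
            (pow_le_pow_left₀ (norm_nonneg _) (hDe t ht) k)) (norm_nonneg _))
      have h2 := norm_le_norm_sub_add (y k t) (P.D t ^ k *ᵥ y 0 t)
      linarith [hdiff t ht]
    have hstate : ∀ t ∈ Set.Icc 0 P.T,
        ‖x k t‖ ≤ 2 * (‖(0 : Fin n → ℝ)‖ + b * (c * P.T + e ^ k) * I) * Real.exp (σ * t) := by
      refine norm_le_exp_of_eq_integral (w := fun s => b * (c * I + e ^ k * ‖y 0 s‖))
        (hsol.continuousOn_state k) ha hσ0 (by linarith) (hsol.state_eq k) ?_
        (continuousOn_const.mul (continuousOn_const.add (continuousOn_const.mul hy0.norm))) ?_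
      · refine (ae_restrict_iff' measurableSet_Icc).2 (Eventually.of_forall fun s hs => ?_)
        refine (norm_add_le _ _).trans (add_le_add ?_ ?_)
        · exact (Matrix.linfty_opNorm_mulVec _ _).trans
            (mul_le_mul_of_nonneg_right (hAa s hs) (norm_nonneg _))
        · exact (Matrix.linfty_opNorm_mulVec _ _).trans
            (mul_le_mul (hBb s hs) (hyk s hs) (norm_nonneg _) hb)
      · intro t ht
        have hsub : Set.uIcc 0 t ⊆ Set.Icc 0 P.T := by
          rw [Set.uIcc_of_le ht.1]
          exact Set.Icc_subset_Icc_right ht.2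
        have hi : IntervalIntegrable (fun s => e ^ k * ‖y 0 s‖) volume 0 t :=
          (continuousOn_const.mul (hy0.mono hsub).norm).intervalIntegrable
        rw [intervalIntegral.integral_const_mul,
          intervalIntegral.integral_add intervalIntegrable_const hi,
          intervalIntegral.integral_const, intervalIntegral.integral_const_mul, smul_eq_mul,
          sub_zero]
        have h1 : t * (c * I) ≤ P.T * (c * I) :=
          mul_le_mul_of_nonneg_right ht.2 (mul_nonneg hc hI)
        have h2 := mul_le_mul_of_nonneg_left (hyI t ht) (pow_nonneg he k)
        have h3 := mul_le_mul_of_nonneg_left (add_le_add h1 h2) hb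
        have h4 : b * (c * P.T + e ^ k) * I ≤ b * (c * P.T + e ^ k) * I * Real.exp (σ * t) :=
          le_mul_of_one_le_right (by positivity) (Real.one_le_exp (mul_nonneg hσ0.le ht.1))
        linarith
    intro t ht
    have hsplit : y (k + 1) t - P.D t ^ (k + 1) *ᵥ y 0 t =
        P.C t *ᵥ x k t + P.D t *ᵥ (y k t - P.D t ^ k *ᵥ y 0 t) := by
      rw [hout k t ht, Matrix.mulVec_sub, Matrix.mulVec_mulVec, ← pow_succ', add_sub_assoc]
    have hx : ‖x k t‖ ≤ 2 * (b * (c * P.T + e ^ k)) * Real.exp (σ * P.T) * I := by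
      refine (hstate t ht).trans ?_
      have h1 : Real.exp (σ * t) ≤ Real.exp (σ * P.T) :=
        Real.exp_le_exp.2 (mul_le_mul_of_nonneg_left ht.2 hσ0.le)
      rw [norm_zero, zero_add]
      calc _ ≤ 2 * (b * (c * P.T + e ^ k) * I) * Real.exp (σ * P.T) := by gcongr
        _ = _ := by ring
    have h1 : ‖P.C t *ᵥ x k t‖ ≤ d * (2 * (b * (c * P.T + e ^ k)) * Real.exp (σ * P.T) * I) :=
      (Matrix.linfty_opNorm_mulVec _ _).trans (mul_le_mul (hCd t ht) hx (norm_nonneg _) hd)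
    have h2 : ‖P.D t *ᵥ (y k t - P.D t ^ k *ᵥ y 0 t)‖ ≤ e * (c * I) :=
      (Matrix.linfty_opNorm_mulVec _ _).trans
        (mul_le_mul (hDe t ht) (hdiff t ht) (norm_nonneg _) he)
    rw [hsplit]
    exact (norm_add_le _ _).trans ((add_le_add h1 h2).trans_eq (by ring))

theorem norm_le_of_signalNorm_le (hT : 0 < P.T) {y : ℝ → Fin m → ℝ} {c : ℝ} (hc : 0 ≤ c)
    (hy : ContinuousOn y (Set.Icc 0 P.T)) (h : P.signalNorm y ≤ ENNReal.ofReal c) :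
    ∀ t ∈ Set.Icc 0 P.T, ‖y t‖ ≤ c := by
  -- As an equality max ‖y‖ c = c, the bound passes from almost everywhere to everywhere by
  -- continuity, endpoints included.
  have hae : (fun t => max ‖y t‖ c) =ᵐ[volume.restrict (Set.Icc 0 P.T)] fun _ => c := by
    filter_upwards [ae_norm_le_signalNorm (h.trans_lt ENNReal.ofReal_lt_top).ne] with t ht
    exact max_eq_right (ht.trans (ENNReal.toReal_le_of_le_ofReal hc h))
  have heq := Measure.eqOn_Icc_of_ae_eq volume hT.ne hae (hy.norm.sup continuousOn_const)
    continuousOn_const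
  exact fun t ht => max_eq_right_iff.1 (heq ht)

/-- An exponential bound on the outputs with zero initial states bounds the powers of `D(t)`. -/
theorem norm_pow_le_of_signalNorm_le (hT : 0 < P.T)
    (hA : ContinuousOn P.A (Set.Icc 0 P.T)) (hB : ContinuousOn P.B (Set.Icc 0 P.T))
    (hC : ContinuousOn P.C (Set.Icc 0 P.T)) (hD : ContinuousOn P.D (Set.Icc 0 P.T))
    {k : ℕ} {g : ℝ} (hg : 0 ≤ g)
    (h : ∀ x y, P.IsSolution 0 x y → P.signalNorm (y 0) ≠ ⊤ →
      P.signalNorm (y k) ≤ ENNReal.ofReal g * P.signalNorm (y 0)) :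
    ∀ t ∈ Set.Icc 0 P.T, ‖P.D t ^ k‖ ≤ g := by
  intro t₀ ht₀
  obtain ⟨c, hc, hdiff⟩ := exists_norm_sub_pow_mulVec_le hT.le hA hB hC hD k
  rw [Matrix.linfty_opNorm_eq_opNorm]
  refine ContinuousLinearMap.opNorm_le_bound _ hg fun v => ?_
  change ‖P.D t₀ ^ k *ᵥ v‖ ≤ g * ‖v‖
  refine le_of_forall_pos_le_add fun ε hε => ?_
  have hden : 0 < c * Real.pi * ‖v‖ + 1 := by
    have := Real.pi_pos
    positivity
  -- This width makes the error c·π·w·‖v‖ at most ε; the 1 keeps the denominator positive.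
  set w := ε / (c * Real.pi * ‖v‖ + 1) with hw
  have hw0 : 0 < w := by positivity
  have hcont : Continuous fun t => lorentzBump t₀ w t • v :=
    (continuous_lorentzBump t₀ w).smul continuous_const
  obtain ⟨x, y, hsol, hy0, hyc, hout⟩ :=
    exists_continuous_solution hT.le hA hB hC hD hcont.continuousOn
  have hnorm : ∀ t, ‖y 0 t‖ = lorentzBump t₀ w t * ‖v‖ := fun t => by
    rw [hy0, norm_smul, Real.norm_of_nonneg (lorentzBump_nonneg _ _ _)]
  have hS : P.signalNorm (y 0) ≤ ENNReal.ofReal ‖v‖ := by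
    refine signalNorm_le_of_ae_bound (Eventually.of_forall fun t => ?_)
    rw [hnorm]
    exact mul_le_of_le_one_left (norm_nonneg _) (lorentzBump_le_one _ _ _)
  have hyk : P.signalNorm (y k) ≤ ENNReal.ofReal (g * ‖v‖) := by
    rw [ENNReal.ofReal_mul hg]
    exact (h x y hsol (hS.trans_lt ENNReal.ofReal_lt_top).ne).trans (mul_le_mul_right hS _)
  have h1 := norm_le_of_signalNorm_le hT (by positivity) (hyc k) hyk t₀ ht₀
  have h2 := hdiff x y hsol (hyc 0) hout (Real.pi * w * ‖v‖)
    (by have := Real.pi_pos; positivity) (fun t _ => by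
      simp only [hnorm]
      rw [intervalIntegral.integral_mul_const]
      exact mul_le_mul_of_nonneg_right (integral_lorentzBump_le hw0 _ _) (norm_nonneg _)) t₀ ht₀
  have hy00 : y 0 t₀ = v := by simp [hy0, lorentzBump_self]
  rw [hy00] at h2
  have h3 : c * (Real.pi * w * ‖v‖) ≤ ε := by
    have : w * (c * Real.pi * ‖v‖ + 1) = ε := div_mul_cancel₀ _ hden.ne'
    linarith
  have h4 := norm_le_norm_sub_add (P.D t₀ ^ k *ᵥ v) (y k t₀)
  rw [norm_sub_rev] at h4
  linarith

theorem rhoD_lt_one_of_zeroIS (hT : 0 < P.T)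
    (hA : ContinuousOn P.A (Set.Icc 0 P.T)) (hB : ContinuousOn P.B (Set.Icc 0 P.T))
    (hC : ContinuousOn P.C (Set.Icc 0 P.T)) (hD : ContinuousOn P.D (Set.Icc 0 P.T))
    (h : P.ZeroISGloballyExponentiallyStable) : ∀ t ∈ Set.Icc 0 P.T, P.rhoD t < 1 := by
  obtain ⟨-, K, γ, -, -, hK, -, -, hγ, hbd⟩ := h
  have hmem : (1 / 2 : ℝ) ∈ Set.Ioo (0 : ℝ) 1 := by norm_num
  obtain ⟨hγ0, hγ1⟩ := hγ _ hmem
  have hK1 := hK _ hmem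
  have hlim : Tendsto (fun k : ℕ => K (1 / 2) * γ (1 / 2) ^ k) atTop (𝓝 0) := by
    simpa using (tendsto_pow_atTop_nhds_zero_of_lt_one hγ0.le hγ1).const_mul (K (1 / 2))
  obtain ⟨k, hk, hk0⟩ := ((hlim.eventually (gt_mem_nhds one_pos)).and
    (eventually_ne_atTop 0)).exists
  have hexp : expNorm (1 / 2) (0 : ℕ → Fin n → ℝ) = 0 := by simp [expNorm]
  have hpow := norm_pow_le_of_signalNorm_le (k := k) (g := K (1 / 2) * γ (1 / 2) ^ k) hT hA hB hC hD
    (by positivity) (fun x y hsol hfin => by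
      -- The radius is picked after the solution, so every finite ‖y_0‖ is covered with the same K
      -- and γ.
      obtain ⟨δ, hδ0, hδ, hδb⟩ := hbd (P.signalNorm (y 0)).toReal
      have := hδb _ hmem 0 rfl x y hsol
        (by
          rw [hexp, add_zero]
          exact (ENNReal.lt_ofReal_iff_toReal_lt hfin).2 hδ) k
      rwa [hexp, add_zero] at this)
  intro t ht
  refine (Matrix.spectralRadius_le_norm_pow (P.D t) hk0).trans_lt ?_
  refine ENNReal.rpow_lt_one ?_ (by positivity)
  exact_mod_cast (hpow t ht).trans_lt hk

theorem GloballyExponentiallyStableOn.mono {X Y : Set (ℕ → Fin n → ℝ)} (hXY : X ⊆ Y)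
    (h : P.GloballyExponentiallyStableOn Y) : P.GloballyExponentiallyStableOn X := by
  obtain ⟨⟨hL, hAtt⟩, K, γ, hKc, hKm, hK1, hγc, hγm, hγ, hbd⟩ := h
  refine ⟨⟨fun ε hε => ?_, fun R => ?_⟩, K, γ, hKc, hKm, hK1, hγc, hγm, hγ, fun R => ?_⟩
  · obtain ⟨δ, h0, hlt, h⟩ := hL ε hε
    exact ⟨δ, h0, hlt, fun x0 hx0 => h x0 (hXY hx0)⟩
  · obtain ⟨δ, h0, hlt, h⟩ := hAtt R
    exact ⟨δ, h0, hlt, fun x0 hx0 => h x0 (hXY hx0)⟩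
  · obtain ⟨δ, h0, hlt, h⟩ := hbd R
    exact ⟨δ, h0, hlt, fun lam hlam x0 hx0 => h lam hlam x0 (hXY hx0)⟩

end LTVProcess

theorem mainTheorem2 {n m : ℕ} (P : LTVProcess n m) (hT : 0 < P.T)
    (hA : ContinuousOn P.A (Set.Icc 0 P.T)) (hB : ContinuousOn P.B (Set.Icc 0 P.T))
    (hC : ContinuousOn P.C (Set.Icc 0 P.T)) (hD : ContinuousOn P.D (Set.Icc 0 P.T)) :
    List.TFAE [
      P.GloballyExponentiallyStable,
      P.ZeroISGloballyExponentiallyStable,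
      ∃ r : ℝ≥0∞, IsGreatest (P.rhoD '' Set.Icc 0 P.T) r ∧ r < 1] := by
  tfae_have 1 → 2 := fun h => h.mono (Set.subset_univ _)
  tfae_have 2 → 3 := by
    intro h
    have hlt := LTVProcess.rhoD_lt_one_of_zeroIS hT hA hB hC hD h
    obtain ⟨t, ht, hmax⟩ := (upperSemicontinuousOn_spectralRadius hD).exists_isMaxOn
      (Set.nonempty_Icc.2 hT.le) isCompact_Icc
    refine ⟨P.rhoD t, ⟨⟨t, ht, rfl⟩, ?_⟩, hlt t ht⟩
    rintro _ ⟨s, hs, rfl⟩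
    exact hmax hs
  tfae_have 3 → 1 := by
    rintro ⟨r, ⟨-, hr⟩, hr1⟩
    exact LTVProcess.globallyExponentiallyStable_of_rhoD_lt_one hA hB hC hD
      fun t ht => (hr ⟨t, ht, rfl⟩).trans_lt hr1
  tfae_finish
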